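/- Let $f=f(n)>0$ for every $n\ge1$. Consider the complete graph on the vertex set $V=\{1,\dots,n\}$. Draw edge weights $w(e)$ independently from the exponential distribution with parameter $1$, and let $d(u,v)$ be the minimum total weight of a $u,v$-path. Every vertex can be opened as a facility at the same cost $f$. The cost of opening a nonempty set $U\subseteq V$ is $c(U)=f\,|U|+\sum_{v\in V}\min_{u\in U}d(u,v)$, and $\mathsf{OPT}=\min_{\varnothing\ne U\subseteq V}c(U)$. Let $\kappa=\kappa(n)=\max\{i\in\{1,\dots,n\}: f<1/(i-1)\}$, where $1/0=\infty$. Then $\kappa=\min\{\lceil 1/f\rceil,n\}$. Suppose that $\kappa=\Theta(n)$ as $n\to\infty$. For each $n$ let $U_n\subseteq V$ be any set of $\kappa$ facilities, chosen independently of the edge weights, and let $\mathsf{ALG}=c(U_n)$. Then, as $n\to\infty$, the expectation $\mathbb{E}[\mathsf{ALG}/\mathsf{OPT}]$, which is finite for every $n\ge1$, satisfies $$\mathbb{E}\left[\frac{\mathsf{ALG}}{\mathsf{OPT}}\right]=O(1)+O\left(\sqrt[4]{\ln(n)\,n^3f^3}\right),$$ and in particular $\mathbb{E}[\mathsf{ALG}/\mathsf{OPT}]=O\big(\sqrt[4]{\ln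 n}\big)$. If $f=O\big(1/(n\sqrt[3]{\ln n})\big)$, then $\mathbb{E}[\mathsf{ALG}/\mathsf{OPT}]=O(1)$. If $f=o(1/n^3)$, then $\mathbb{E}[\mathsf{ALG}/\mathsf{OPT}]=1+o(1)$. -/

import Mathlib

open MeasureTheory ProbabilityTheory Filter Topology Asymptotics

namespace FacilityLocation

/-- The edges of the complete graph on the vertex set `V`. -/
abbrev Edge (V : Type) : Type := (⊤ : SimpleGraph V).edgeSet

/-- The total weight of a walk in the complete graph, each edge on it being counted once
(a path uses each of its edges exactly once). -/
noncomputable def pathWeight {V : Type} [Fintype V] [DecidableEq V] (w : Edge V → ℝ)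
    {u v : V} (p : (⊤ : SimpleGraph V).Walk u v) : ℝ :=
  ∑ e ∈ Finset.univ.filter (fun e : Edge V => (e : Sym2 V) ∈ p.edges), w e

/-- The shortest path distance: the minimum total weight of a path from `u` to `v` in the
complete graph (the infimum runs over a finite nonempty type). -/
noncomputable def spDist {V : Type} [Fintype V] [DecidableEq V] (w : Edge V → ℝ) (u v : V) : ℝ :=
  ⨅ p : (⊤ : SimpleGraph V).Path u v, pathWeight w p.1

/-- The total cost of the solution that opens the facilities in `U`: the opening costs of `U`
plus, for every vertex, the distance to the nearest open facility. -/
noncomputable def totalCost {V : Type} [Fintype V] [DecidableEq V] (c : V → ℝ)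
    (w : Edge V → ℝ) (U : Finset V) : ℝ :=
  ∑ u ∈ U, c u + ∑ v : V, ⨅ u : {u : V // u ∈ U}, spDist w u v

/-- The cost of an optimal solution: the minimum over all nonempty sets of open facilities. -/
noncomputable def opt {V : Type} [Fintype V] [DecidableEq V] (c : V → ℝ)
    (w : Edge V → ℝ) : ℝ :=
  ⨅ U : {U : Finset V // U.Nonempty}, totalCost c w U.1

open Classical in
/-- For opening costs `c₁ ≤ … ≤ cₙ`, the number `max {i ∈ {1, …, n} : cᵢ < 1 / (i - 1)}`, where
`1 / 0 = ∞`. The index `i` is `j + 1` for `j : Fin n`. -/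
noncomputable def kappa {n : ℕ} (c : Fin n → ℝ) : ℕ :=
  (Finset.univ.filter fun j : Fin n => (j : ℕ) = 0 ∨ c j < 1 / ((j : ℕ) : ℝ)).sup
    fun j => (j : ℕ) + 1

/-- The joint law of the edge weights of the complete graph on `n` vertices: independent
exponential random variables with parameter `1`. -/
noncomputable def weightLaw (n : ℕ) : Measure (Edge (Fin n) → ℝ) :=
  Measure.pi fun _ => expMeasure 1

/-- The approximation ratio of the solution that opens the facilities in `U`, for edge
weights `w` and opening costs all equal to `f`. -/
noncomputable def ratio {n : ℕ} (f : ℝ) (U : Finset (Fin n)) (w : Edge (Fin n) → ℝ) : ℝ :=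
  totalCost (fun _ => f) w U / opt (fun _ => f) w

/-- The expected approximation ratio. -/
noncomputable def expectedRatio {n : ℕ} (f : ℝ) (U : Finset (Fin n)) : ℝ :=
  ∫ w, ratio f U w ∂(weightLaw n)

end FacilityLocation

/-! The proof gives more than the fourth-root bound: the expected ratio is `O(1)` whenever `κ =
Θ(n)`, and the three big-O claims weaken this. Since `κ ≤ 1/f + 1`, the product `n f` stays bounded,
so a constant `δ` can be chosen with `n δ f ≤ 1/64`.

Lower bound on the optimum. Call an edge light if it weighs less than `δ f`. A vertex touching no
light edge costs any solution at least `δ f`, through its own opening cost or through the last edge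
of its connecting path (`mul_card_sub_le_opt`). With fewer than `n/4` light edges, at least half of
the vertices pay, so `opt ≥ δ f n / 2`.

Upper bound on the algorithm. Replace shortest paths by single edges, giving the direct cost `D`,
whose mean is at most `n/κ`. Either every vertex is open and `D = 0`, or `n f ≥ 1`; in both cases
the cost is at most `n f (1 + D)`. Under the lower bound, the ratio is at most `(2/δ)(1 + D)`.

The remaining event, with at least `n/4` light edges, is exponentially unlikely by a Chernoff bound,
while `f ≤ opt` still gives the polynomial bound `n (1 + D)` there. `ratio_le` packs both cases into
one pointwise inequality, so that only expectations have to be computed.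

If `f = o(1/n^3)`, all vertices are eventually open and the ratio is 1 unless some edge is lighter
than `f`; this exceptional event adds at most `n^3 f` to the expectation. -/

namespace FacilityLocation

/-! ### Bounds on costs for fixed edge weights. -/

section Deterministic

variable {V : Type} [DecidableEq V]

/-- The weight of the edge between `u` and `v`, and `0` if `u = v`. -/
noncomputable def edgeWeight (w : Edge V → ℝ) (u v : V) : ℝ :=
  if h : u ≠ v then w ⟨s(u, v), by simpa using h⟩ else 0

lemma edgeWeight_nonneg {w : Edge V → ℝ} (hw : ∀ e, 0 ≤ w e) (u v : V) :
    0 ≤ edgeWeight w u v := by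
  unfold edgeWeight; split_ifs
  · exact hw _
  · exact le_rfl

lemma iInf_edgeWeight_nonneg {w : Edge V → ℝ} (hw : ∀ e, 0 ≤ w e) (U : Finset V) (v : V) :
    0 ≤ ⨅ u : {u : V // u ∈ U}, edgeWeight w u v :=
  Real.iInf_nonneg fun u => edgeWeight_nonneg hw u v

variable [Fintype V]

/-- The cost of connecting every vertex to `U` by a single edge. -/
noncomputable def directCost (w : Edge V → ℝ) (U : Finset V) : ℝ :=
  ∑ v : V, ⨅ u : {u : V // u ∈ U}, edgeWeight w u v

/-- The number of edges of weight less than `t`. -/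
noncomputable def lightCount (w : Edge V → ℝ) (t : ℝ) : ℕ :=
  (Finset.univ.filter fun e : Edge V => w e < t).card

lemma edgeWeight_le_sum {w : Edge V → ℝ} (hw : ∀ e, 0 ≤ w e) (u v : V) :
    edgeWeight w u v ≤ ∑ e, w e := by
  unfold edgeWeight; split_ifs
  · exact Finset.single_le_sum (fun e _ => hw e) (Finset.mem_univ _)
  · exact Finset.sum_nonneg fun e _ => hw e

lemma pathWeight_nonneg {w : Edge V → ℝ} (hw : ∀ e, 0 ≤ w e) {u v : V}
    (p : (⊤ : SimpleGraph V).Walk u v) : 0 ≤ pathWeight w p :=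
  Finset.sum_nonneg fun e _ => hw e

lemma spDist_nonneg {w : Edge V → ℝ} (hw : ∀ e, 0 ≤ w e) (u v : V) : 0 ≤ spDist w u v :=
  Real.iInf_nonneg fun p => pathWeight_nonneg hw p.1

lemma spDist_le_pathWeight (w : Edge V → ℝ) {u v : V} (p : (⊤ : SimpleGraph V).Path u v) :
    spDist w u v ≤ pathWeight w p.1 :=
  ciInf_le (Set.finite_range _).bddBelow p

lemma spDist_le_edgeWeight (w : Edge V → ℝ) (u v : V) : spDist w u v ≤ edgeWeight w u v := by
  unfold edgeWeight
  split_ifs with h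
  · have hadj : (⊤ : SimpleGraph V).Adj u v := by simpa using h
    refine (spDist_le_pathWeight w (SimpleGraph.Path.singleton hadj)).trans_eq ?_
    unfold pathWeight
    rw [Finset.sum_eq_single_of_mem ⟨s(u, v), by simpa using h⟩]
    · simp [SimpleGraph.Path.singleton]
    · intro e he hne
      simp only [SimpleGraph.Path.singleton, SimpleGraph.Walk.edges_cons,
        SimpleGraph.Walk.edges_nil, List.mem_singleton, Finset.mem_filter] at he
      exact absurd (Subtype.ext he.2) hne
  · obtain rfl : u = v := by simpa using h
    refine (spDist_le_pathWeight w SimpleGraph.Path.nil).trans_eq ?_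
    simp [pathWeight, SimpleGraph.Path.nil]

lemma directCost_nonneg {w : Edge V → ℝ} (hw : ∀ e, 0 ≤ w e) (U : Finset V) :
    0 ≤ directCost w U :=
  Finset.sum_nonneg fun v _ => iInf_edgeWeight_nonneg hw U v

lemma totalCost_le (f : ℝ) (w : Edge V → ℝ) {U : Finset V} (hU : U.Nonempty) :
    totalCost (fun _ => f) w U ≤ f * U.card + directCost w U := by
  have : Nonempty {u : V // u ∈ U} := hU.to_subtype
  unfold totalCost directCost
  rw [Finset.sum_const, nsmul_eq_mul, mul_comm]
  refine add_le_add le_rfl (Finset.sum_le_sum fun v _ => ?_)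
  exact ciInf_mono (Set.finite_range _).bddBelow fun u => spDist_le_edgeWeight w u v

lemma iInf_edgeWeight_of_mem {w : Edge V → ℝ} (hw : ∀ e, 0 ≤ w e) {U : Finset V} {v : V}
    (hv : v ∈ U) : ⨅ u : {u : V // u ∈ U}, edgeWeight w u v = 0 := by
  refine le_antisymm ((ciInf_le (Set.finite_range _).bddBelow ⟨v, hv⟩).trans_eq ?_)
    (iInf_edgeWeight_nonneg hw U v)
  simp [edgeWeight]

lemma directCost_univ {w : Edge V → ℝ} (hw : ∀ e, 0 ≤ w e) : directCost w Finset.univ = 0 :=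
  Finset.sum_eq_zero fun v _ => iInf_edgeWeight_of_mem hw (Finset.mem_univ v)

lemma iInf_edgeWeight_le_sum {w : Edge V → ℝ} (hw : ∀ e, 0 ≤ w e) {U : Finset V}
    (hU : U.Nonempty) (v : V) :
    ⨅ u : {u : V // u ∈ U}, edgeWeight w u v ≤ ∑ e, w e := by
  obtain ⟨u, hu⟩ := hU
  exact (ciInf_le (Set.finite_range _).bddBelow ⟨u, hu⟩).trans (edgeWeight_le_sum hw u v)

lemma directCost_le {w : Edge V → ℝ} (hw : ∀ e, 0 ≤ w e) {U : Finset V} (hU : U.Nonempty) :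
    directCost w U ≤ Fintype.card V * ∑ e, w e := by
  calc directCost w U ≤ ∑ _v : V, ∑ e, w e :=
        Finset.sum_le_sum fun v _ => iInf_edgeWeight_le_sum hw hU v
    _ = _ := by simp

lemma le_totalCost {f : ℝ} {w : Edge V → ℝ} (hw : ∀ e, 0 ≤ w e) (U : Finset V) :
    f * U.card ≤ totalCost (fun _ => f) w U := by
  unfold totalCost
  rw [Finset.sum_const, nsmul_eq_mul, mul_comm]
  exact le_add_of_nonneg_right (Finset.sum_nonneg fun v _ =>
    Real.iInf_nonneg fun u => spDist_nonneg hw u v)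

lemma le_opt [Nonempty V] {f : ℝ} (hf : 0 ≤ f) {w : Edge V → ℝ} (hw : ∀ e, 0 ≤ w e) :
    f ≤ opt (fun _ => f) w := by
  have : Nonempty {U : Finset V // U.Nonempty} := ⟨⟨Finset.univ, Finset.univ_nonempty⟩⟩
  refine le_ciInf fun U => le_trans ?_ (le_totalCost hw U.1)
  have : (1 : ℝ) ≤ U.1.card := by exact_mod_cast U.2.card_pos
  nlinarith

lemma opt_le_totalCost (f : ℝ) (w : Edge V → ℝ) {U : Finset V} (hU : U.Nonempty) :
    opt (fun _ => f) w ≤ totalCost (fun _ => f) w U :=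
  ciInf_le (f := fun U : {U : Finset V // U.Nonempty} => totalCost (fun _ => f) w U.1)
    (Set.finite_range _).bddBelow ⟨U, hU⟩

open Classical in
/-- The vertices incident to an edge of weight less than `t`. -/
noncomputable def lightVertices (w : Edge V → ℝ) (t : ℝ) : Finset V :=
  Finset.univ.filter fun v => ∃ e : Edge V, w e < t ∧ v ∈ (e : Sym2 V)

lemma card_lightVertices_le (w : Edge V → ℝ) (t : ℝ) :
    (lightVertices w t).card ≤ 2 * lightCount w t := by
  have hsub : lightVertices w t ⊆
      (Finset.univ.filter fun e : Edge V => w e < t).biUnion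
        fun e => (e : Sym2 V).toFinset := by
    intro v hv
    obtain ⟨e, he, hve⟩ := (Finset.mem_filter.1 hv).2
    exact Finset.mem_biUnion.2 ⟨e, by simpa using he, by simpa using hve⟩
  refine (Finset.card_le_card hsub).trans ?_
  rw [mul_comm]
  refine Finset.card_biUnion_le_card_mul _ _ 2 fun e _ => ?_
  rw [Sym2.card_toFinset]
  split_ifs <;> norm_num

/-- The last edge of any path to `v` is incident to `v`, hence not light, and it alone already
weighs `t`. -/
lemma le_spDist_of_notMem_lightVertices {w : Edge V → ℝ} (hw : ∀ e, 0 ≤ w e) {t : ℝ} {u v : V}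
    (huv : u ≠ v) (hv : v ∉ lightVertices w t) : t ≤ spDist w u v := by
  have hadj : (⊤ : SimpleGraph V).Adj u v := by simpa using huv
  have : Nonempty ((⊤ : SimpleGraph V).Path u v) := ⟨SimpleGraph.Path.singleton hadj⟩
  refine le_ciInf fun p => ?_
  obtain ⟨e, hep, hve⟩ : ∃ e ∈ p.1.edges, v ∈ e := by
    have hnil : ¬ p.1.Nil := SimpleGraph.Walk.not_nil_of_ne huv
    exact ⟨s(p.1.penultimate, v), p.1.mk_penultimate_end_mem_edges hnil, by simp⟩
  let e' : Edge V := ⟨e, p.1.edges_subset_edgeSet hep⟩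
  have ht : t ≤ w e' := by
    by_contra h
    exact hv (Finset.mem_filter.2 ⟨Finset.mem_univ _, e', not_le.1 h, hve⟩)
  exact ht.trans (Finset.single_le_sum (f := w) (fun e _ => hw e)
    (Finset.mem_filter.2 ⟨Finset.mem_univ e', hep⟩))

/-- Charge each vertex its own share of the cost: `f ≥ t` if it is open, its connection distance
otherwise. Vertices off all light edges pay at least `t`, and each light edge exempts at most two
vertices. -/
lemma mul_card_sub_le_opt [Nonempty V] {f t : ℝ} (ht : 0 ≤ t) (htf : t ≤ f) {w : Edge V → ℝ}
    (hw : ∀ e, 0 ≤ w e) :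
    t * (Fintype.card V - 2 * lightCount w t) ≤ opt (fun _ => f) w := by
  have : Nonempty {U : Finset V // U.Nonempty} := ⟨⟨Finset.univ, Finset.univ_nonempty⟩⟩
  refine le_ciInf fun ⟨U, hU⟩ => ?_
  have : Nonempty {u : V // u ∈ U} := hU.to_subtype
  have key : ∑ v : V, (if v ∈ lightVertices w t then 0 else t) ≤
      ∑ v : V, ((if v ∈ U then f else 0) + ⨅ u : {u : V // u ∈ U}, spDist w u v) := by
    refine Finset.sum_le_sum fun v _ => ?_
    have h0 : 0 ≤ ⨅ u : {u : V // u ∈ U}, spDist w u v :=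
      Real.iInf_nonneg fun u => spDist_nonneg hw u v
    by_cases hvU : v ∈ U
    · rw [if_pos hvU]
      split_ifs <;> linarith
    · rw [if_neg hvU, zero_add]
      split_ifs with hv
      · exact h0
      · exact le_ciInf fun u => le_spDist_of_notMem_lightVertices hw
          (fun h => hvU (h ▸ u.2)) hv
  have hl : ∑ v : V, (if v ∈ lightVertices w t then 0 else t) =
      t * (Fintype.card V - (lightVertices w t).card) := by
    have : ∀ v : V, (if v ∈ lightVertices w t then 0 else t) =
        t - (if v ∈ lightVertices w t then t else 0) := fun v => by split_ifs <;> ring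
    simp only [this, Finset.sum_sub_distrib, Finset.sum_ite_mem, Finset.univ_inter,
      Finset.sum_const, nsmul_eq_mul, Finset.card_univ]
    ring
  have hr : ∑ v : V, ((if v ∈ U then f else 0) + ⨅ u : {u : V // u ∈ U}, spDist w u v) =
      totalCost (fun _ => f) w U := by
    simp only [totalCost, Finset.sum_add_distrib, Finset.sum_ite_mem, Finset.univ_inter]
  have hc : ((lightVertices w t).card : ℝ) ≤ 2 * lightCount w t := by
    exact_mod_cast card_lightVertices_le w t
  rw [hl, hr] at key
  refine le_trans ?_ key
  gcongr

end Deterministic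

/-! ### The exponential law: tails and moments. -/

section Exponential

instance isProbabilityMeasure_expMeasure_one : IsProbabilityMeasure (expMeasure 1) :=
  isProbabilityMeasure_expMeasure one_pos

lemma expMeasure_real_Iic {t : ℝ} (ht : 0 ≤ t) :
    (expMeasure 1).real (Set.Iic t) = 1 - Real.exp (-t) := by
  rw [← cdf_eq_real, cdf_expMeasure_eq one_pos, if_pos ht, one_mul]

lemma expMeasure_real_Ioi {t : ℝ} (ht : 0 ≤ t) :
    (expMeasure 1).real (Set.Ioi t) = Real.exp (-t) := by
  rw [← Set.compl_Iic, probReal_compl_eq_one_sub measurableSet_Iic, expMeasure_real_Iic ht]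
  ring

lemma expMeasure_real_Iio_le {t : ℝ} (ht : 0 ≤ t) :
    (expMeasure 1).real (Set.Iio t) ≤ t := by
  refine (measureReal_mono Set.Iio_subset_Iic_self).trans ?_
  rw [expMeasure_real_Iic ht]
  linarith [Real.add_one_le_exp (-t)]

lemma ae_nonneg_expMeasure : ∀ᵐ x ∂(expMeasure 1), 0 ≤ x := by
  have h : expMeasure 1 (Set.Iio 0) = 0 := by
    have := expMeasure_real_Iio_le le_rfl
    have h0 : (expMeasure 1).real (Set.Iio 0) = 0 := le_antisymm this measureReal_nonneg
    rwa [measureReal_eq_zero_iff] at h0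
  rw [ae_iff]
  simpa [Set.Iio] using h

lemma integrable_sq_expMeasure : Integrable (fun x : ℝ => x ^ 2) (expMeasure 1) := by
  have hm : Measurable (gammaPDF 1 1) := (measurable_gammaPDFReal 1 1).ennreal_ofReal
  rw [expMeasure, gammaMeasure, integrable_withDensity_iff hm
    (Eventually.of_forall fun x => ENNReal.ofReal_lt_top)]
  -- The second moment is the Gamma integral at 3, whose integrand is `exp (-x) * x ^ 2`.
  have h := Real.GammaIntegral_convergent (s := 3) (by norm_num)
  rw [← integrableOn_Ici_iff_integrableOn_Ioi] at h
  refine (h.integrable_indicator measurableSet_Ici).congr (Eventually.of_forall fun x => ?_)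
  by_cases hx : 0 ≤ x
  · have : x ^ ((3 : ℝ) - 1) = x ^ 2 := by
      rw [show (3 : ℝ) - 1 = (2 : ℕ) by norm_num, Real.rpow_natCast]
    simp only [Set.indicator_of_mem (Set.mem_Ici.2 hx), gammaPDF_of_nonneg hx, this]
    rw [ENNReal.toReal_ofReal (by simp; positivity)]
    simp [mul_comm]
  · simp [Set.indicator_of_notMem (fun h => hx (Set.mem_Ici.1 h)), gammaPDF_of_neg (not_le.1 hx)]

lemma integrable_id_expMeasure : Integrable (fun x : ℝ => x) (expMeasure 1) := by
  refine ((integrable_const (1 : ℝ)).add integrable_sq_expMeasure).mono'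
    measurable_id.aestronglyMeasurable (Eventually.of_forall fun x => ?_)
  rw [Real.norm_eq_abs, Pi.add_apply, ← sq_abs]
  nlinarith [sq_nonneg (|x| - 1)]

end Exponential

/-! ### Measurability, moments of the weights, and the number of light edges. -/

section Random

variable {n : ℕ}

instance isProbabilityMeasure_weightLaw : IsProbabilityMeasure (weightLaw n) := by
  unfold weightLaw; infer_instance

lemma measurePreserving_eval_weightLaw (e : Edge (Fin n)) :
    MeasurePreserving (Function.eval e) (weightLaw n) (expMeasure 1) :=
  measurePreserving_eval _ e

lemma ae_nonneg_weightLaw : ∀ᵐ w ∂(weightLaw n), ∀ e, 0 ≤ w e :=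
  ae_all_iff.2 fun e =>
    (measurePreserving_eval_weightLaw e).quasiMeasurePreserving.ae ae_nonneg_expMeasure

lemma integrable_weight (e : Edge (Fin n)) : Integrable (fun w => w e) (weightLaw n) :=
  (measurePreserving_eval_weightLaw e).integrable_comp_of_integrable integrable_id_expMeasure

lemma integrable_weight_sq (e : Edge (Fin n)) :
    Integrable (fun w => w e ^ 2) (weightLaw n) :=
  (measurePreserving_eval_weightLaw e).integrable_comp_of_integrable integrable_sq_expMeasure

lemma integral_weight_sq (e : Edge (Fin n)) :
    ∫ w, w e ^ 2 ∂(weightLaw n) = ∫ x, x ^ 2 ∂(expMeasure 1) :=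
  integral_comp_eval (μ := fun _ : Edge (Fin n) => expMeasure 1) (i := e)
    (f := fun x : ℝ => x ^ 2) integrable_sq_expMeasure.aestronglyMeasurable

lemma two_mul_card_edge_le (n : ℕ) : 2 * (Fintype.card (Edge (Fin n)) : ℝ) ≤ (n : ℝ) ^ 2 := by
  have h : Fintype.card (Edge (Fin n)) = n.choose 2 := by
    rw [SimpleGraph.card_edgeSet, SimpleGraph.card_edgeFinset_top_eq_card_choose_two,
      Fintype.card_fin]
  rw [h, Nat.cast_choose_two]
  have : (0 : ℝ) ≤ n := n.cast_nonneg
  nlinarith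

lemma sq_sum_weight_le (w : Edge (Fin n) → ℝ) :
    (∑ e, w e) ^ 2 ≤ (n : ℝ) ^ 2 * ∑ e, w e ^ 2 := by
  refine sq_sum_le_card_mul_sum_sq.trans ?_
  have h := two_mul_card_edge_le n
  gcongr
  rw [Finset.card_univ]
  have : (0 : ℝ) ≤ Fintype.card (Edge (Fin n)) := Nat.cast_nonneg _
  linarith

lemma integrable_sum_weight_sq :
    Integrable (fun w : Edge (Fin n) → ℝ => ∑ e, w e ^ 2) (weightLaw n) :=
  integrable_finsetSum _ fun e _ => integrable_weight_sq e

lemma integral_sum_weight_sq_le :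
    ∫ w, ∑ e, w e ^ 2 ∂(weightLaw n) ≤ (n : ℝ) ^ 2 * ∫ x, x ^ 2 ∂(expMeasure 1) := by
  rw [integral_finsetSum _ fun e _ => integrable_weight_sq e]
  simp only [integral_weight_sq, Finset.sum_const, nsmul_eq_mul, Finset.card_univ]
  have h := two_mul_card_edge_le n
  have : (0 : ℝ) ≤ Fintype.card (Edge (Fin n)) := Nat.cast_nonneg _
  exact mul_le_mul_of_nonneg_right (by linarith) (integral_nonneg fun x => sq_nonneg x)

lemma measurable_edgeWeight (u v : Fin n) :
    Measurable fun w : Edge (Fin n) → ℝ => edgeWeight w u v := by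
  unfold edgeWeight
  split_ifs
  · exact measurable_pi_apply _
  · exact measurable_const

lemma measurable_totalCost (c : Fin n → ℝ) (U : Finset (Fin n)) :
    Measurable fun w : Edge (Fin n) → ℝ => totalCost c w U := by
  refine measurable_const.add (Finset.measurable_fun_sum _ fun v _ =>
    Measurable.iInf fun u => Measurable.iInf fun p => ?_)
  exact Finset.measurable_fun_sum _ fun e _ => measurable_pi_apply e

lemma measurable_opt (c : Fin n → ℝ) :
    Measurable fun w : Edge (Fin n) → ℝ => opt c w :=
  Measurable.iInf fun U => measurable_totalCost c U.1

lemma measurable_ratio (f : ℝ) (U : Finset (Fin n)) : Measurable (ratio f U) :=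
  (measurable_totalCost _ U).div (measurable_opt _)

lemma lightCount_eq_sum {V : Type} [Fintype V] [DecidableEq V] (w : Edge V → ℝ) (t : ℝ) :
    (lightCount w t : ℝ) = ∑ e, (Set.Iio t).indicator 1 (w e) := by
  simp [lightCount, Set.indicator_apply, Finset.sum_boole]

lemma integrable_lightCount (t : ℝ) :
    Integrable (fun w => (lightCount w t : ℝ)) (weightLaw n) := by
  simp only [lightCount_eq_sum]
  refine integrable_finsetSum _ fun e _ =>
    (measurePreserving_eval_weightLaw e).integrable_comp_of_integrable
      (g := (Set.Iio t).indicator 1) ?_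
  exact (integrable_const (1 : ℝ)).indicator measurableSet_Iio

lemma integral_lightCount_le {t : ℝ} (ht : 0 ≤ t) :
    ∫ w, (lightCount w t : ℝ) ∂(weightLaw n) ≤ (n : ℝ) ^ 2 * t := by
  simp only [lightCount_eq_sum]
  have hi : Integrable ((Set.Iio t).indicator (1 : ℝ → ℝ)) (expMeasure 1) :=
    (integrable_const (1 : ℝ)).indicator measurableSet_Iio
  have hi' : ∀ e : Edge (Fin n),
      Integrable (fun w => (Set.Iio t).indicator (1 : ℝ → ℝ) (w e)) (weightLaw n) := fun e =>
    (measurePreserving_eval_weightLaw e).integrable_comp_of_integrable hi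
  rw [integral_finsetSum _ fun e _ => hi' e]
  have h1 : ∀ e : Edge (Fin n),
      ∫ w, (Set.Iio t).indicator (1 : ℝ → ℝ) (w e) ∂(weightLaw n) ≤ t := fun e => by
    refine (integral_comp_eval (μ := fun _ : Edge (Fin n) => expMeasure 1) (i := e)
      hi.aestronglyMeasurable).trans_le ?_
    rw [integral_indicator_one measurableSet_Iio]
    exact expMeasure_real_Iio_le ht
  refine (Finset.sum_le_sum fun e _ => h1 e).trans ?_
  rw [Finset.sum_const, nsmul_eq_mul, Finset.card_univ]
  have h := two_mul_card_edge_le n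
  have : (0 : ℝ) ≤ Fintype.card (Edge (Fin n)) := Nat.cast_nonneg _
  gcongr
  linarith

/-- Writes the exponential as a product of functions of single weights, so that independence factors
its expectation. -/
lemma exp_mul_lightCount_eq_prod {V : Type} [Fintype V] [DecidableEq V] (a : ℝ)
    (w : Edge V → ℝ) (t : ℝ) :
    Real.exp (a * lightCount w t) =
      ∏ e, (1 + (Set.Iio t).indicator (fun _ => Real.exp a - 1) (w e)) := by
  rw [lightCount_eq_sum, Finset.mul_sum, Real.exp_sum]
  refine Finset.prod_congr rfl fun e _ => ?_
  by_cases h : w e ∈ Set.Iio t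
  · simp [Set.indicator_of_mem h]
  · simp [Set.indicator_of_notMem h]

lemma integrable_one_add_indicator (a t : ℝ) : Integrable
    (fun x => 1 + (Set.Iio t).indicator (fun _ => Real.exp a - 1) x) (expMeasure 1) :=
  (integrable_const _).add ((integrable_const _).indicator measurableSet_Iio)

lemma integrable_exp_mul_lightCount (a t : ℝ) :
    Integrable (fun w => Real.exp (a * lightCount w t)) (weightLaw n) := by
  simp only [exp_mul_lightCount_eq_prod]
  exact Integrable.fintype_prod fun _ => integrable_one_add_indicator a t

/-- The Chernoff moment bound: each factor has mean at most `1 + (exp a - 1) t ≤ exp ((exp a - 1)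
t)`, and there are at most `n ^ 2 / 2` edges. -/
lemma integral_exp_mul_lightCount_le {a t : ℝ} (ha : 0 ≤ a) (ht : 0 ≤ t) :
    ∫ w, Real.exp (a * lightCount w t) ∂(weightLaw n) ≤
      Real.exp ((Real.exp a - 1) * t * (n : ℝ) ^ 2 / 2) := by
  simp only [exp_mul_lightCount_eq_prod]
  rw [weightLaw, integral_fintype_prod_eq_prod
    (f := fun _ x => 1 + (Set.Iio t).indicator (fun _ => Real.exp a - 1) x)]
  have ha' : 0 ≤ Real.exp a - 1 := by linarith [Real.add_one_le_exp a]
  have h1 : ∫ x, (1 + (Set.Iio t).indicator (fun _ => Real.exp a - 1) x) ∂(expMeasure 1) ≤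
      Real.exp ((Real.exp a - 1) * t) := by
    rw [integral_add (integrable_const _) ((integrable_const _).indicator measurableSet_Iio),
      integral_indicator_const _ measurableSet_Iio]
    simp only [integral_const, probReal_univ, smul_eq_mul, mul_one]
    have := mul_le_mul_of_nonneg_right (expMeasure_real_Iio_le ht) ha'
    linarith [Real.add_one_le_exp ((Real.exp a - 1) * t)]
  have h0 : 0 ≤ ∫ x, (1 + (Set.Iio t).indicator (fun _ => Real.exp a - 1) x) ∂(expMeasure 1) :=
    integral_nonneg fun x => add_nonneg zero_le_one (Set.indicator_nonneg (fun _ _ => ha') x)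
  rw [Finset.prod_const]
  refine (pow_le_pow_left₀ h0 h1 _).trans ?_
  rw [← Real.exp_nat_mul, Finset.card_univ, Real.exp_le_exp]
  have h := two_mul_card_edge_le n
  have := mul_nonneg ha' ht
  nlinarith

end Random

/-! ### Expected direct connection cost and integrability of the ratio. -/

section Direct

variable {n : ℕ}

/-- The edges from `v` to the members of `U` are distinct, so the event is a box and its probability
a product of exponential tails. -/
lemma weightLaw_forall_lt {U : Finset (Fin n)} {v : Fin n} (hv : v ∉ U) {t : ℝ} (ht : 0 ≤ t) :
    (weightLaw n).real {w | ∀ u ∈ U, t < edgeWeight w u v} = Real.exp (-(U.card * t)) := by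
  classical
  have hne : ∀ u ∈ U, u ≠ v := fun u hu h => hv (h ▸ hu)
  let g : {u // u ∈ U} → Edge (Fin n) := fun u => ⟨s(u.1, v), by simpa using hne u.1 u.2⟩
  have hg : Function.Injective g := fun a b hab => by
    have h : s(a.1, v) = s(b.1, v) := congrArg Subtype.val hab
    exact Subtype.ext (Sym2.congr_left.1 h)
  let F : Finset (Edge (Fin n)) := Finset.univ.image g
  have hF : F.card = U.card := by
    rw [Finset.card_image_of_injective _ hg]; simp
  have hset : {w : Edge (Fin n) → ℝ | ∀ u ∈ U, t < edgeWeight w u v} =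
      Set.pi Set.univ fun e => if e ∈ F then Set.Ioi t else Set.univ := by
    ext w
    simp only [Set.mem_ofPred_eq, Set.mem_pi, Set.mem_univ, true_imp_iff]
    constructor
    · intro h e
      split_ifs with he
      · obtain ⟨u, -, rfl⟩ := Finset.mem_image.1 he
        have := h u.1 u.2
        rwa [edgeWeight, dif_pos (hne u.1 u.2)] at this
      · trivial
    · intro h u hu
      have := h (g ⟨u, hu⟩)
      rw [if_pos (Finset.mem_image_of_mem _ (Finset.mem_univ _))] at this
      rwa [edgeWeight, dif_pos (hne u hu)]
  rw [hset, measureReal_def, weightLaw, Measure.pi_pi, ENNReal.toReal_prod]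
  have h1 : ∀ e, ((expMeasure 1) (if e ∈ F then Set.Ioi t else Set.univ)).toReal =
      if e ∈ F then Real.exp (-t) else 1 := fun e => by
    split_ifs
    · exact expMeasure_real_Ioi ht
    · simp
  simp only [h1, Finset.prod_ite_mem, Finset.univ_inter, Finset.prod_const, hF]
  rw [← Real.exp_nat_mul]
  congr 1; ring

lemma integrable_iInf_edgeWeight {U : Finset (Fin n)} (hU : U.Nonempty) (v : Fin n) :
    Integrable (fun w => ⨅ u : {u // u ∈ U}, edgeWeight w (u : Fin n) v) (weightLaw n) := by
  have hs : Integrable (fun w : Edge (Fin n) → ℝ => ∑ e, w e) (weightLaw n) :=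
    integrable_finsetSum _ fun e _ => integrable_weight e
  have hm : Measurable fun w : Edge (Fin n) → ℝ =>
      ⨅ u : {u // u ∈ U}, edgeWeight w (u : Fin n) v :=
    Measurable.iInf fun u => measurable_edgeWeight u.1 v
  refine hs.mono' hm.aestronglyMeasurable (ae_nonneg_weightLaw.mono fun w hw => ?_)
  rw [Real.norm_eq_abs, abs_of_nonneg (iInf_edgeWeight_nonneg hw U v)]
  exact iInf_edgeWeight_le_sum hw hU v

/-- For `v` outside `U` this is the minimum of `U.card` independent exponentials; integrate its
tail. -/
lemma integral_iInf_edgeWeight_le {U : Finset (Fin n)} (hU : U.Nonempty) (v : Fin n) :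
    ∫ w, ⨅ u : {u // u ∈ U}, edgeWeight w (u : Fin n) v ∂(weightLaw n) ≤ 1 / U.card := by
  have hnn : 0 ≤ᵐ[weightLaw n] fun w => ⨅ u : {u // u ∈ U}, edgeWeight w (u : Fin n) v := by
    filter_upwards [ae_nonneg_weightLaw] with w hw
    exact iInf_edgeWeight_nonneg hw U v
  by_cases hv : v ∈ U
  · rw [integral_congr_ae (g := fun _ => 0), integral_zero]
    · positivity
    · filter_upwards [ae_nonneg_weightLaw] with w hw
      exact iInf_edgeWeight_of_mem hw hv
  have hk : (0 : ℝ) < U.card := by exact_mod_cast hU.card_pos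
  rw [(integrable_iInf_edgeWeight hU v).integral_eq_integral_meas_lt hnn]
  calc _ ≤ ∫ t in Set.Ioi (0 : ℝ), Real.exp (-(U.card : ℝ) * t) := by
        refine integral_mono_of_nonneg (Eventually.of_forall fun t => measureReal_nonneg)
          (exp_neg_integrableOn_Ioi 0 hk) ?_
        filter_upwards [ae_restrict_mem measurableSet_Ioi] with t ht
        refine (measureReal_mono ?_).trans_eq
          ((weightLaw_forall_lt hv (le_of_lt ht)).trans (by rw [neg_mul]))
        intro w hw u hu
        exact lt_of_lt_of_le hw (ciInf_le (f := fun u : {u // u ∈ U} => edgeWeight w (u : Fin n) v)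
          (Set.finite_range _).bddBelow ⟨u, hu⟩)
    _ = 1 / U.card := by
        rw [integral_exp_mul_Ioi (by linarith)]
        simp [neg_div_neg_eq]

lemma integrable_directCost {U : Finset (Fin n)} (hU : U.Nonempty) :
    Integrable (fun w => directCost w U) (weightLaw n) :=
  integrable_finsetSum _ fun v _ => integrable_iInf_edgeWeight hU v

lemma integral_directCost_le {U : Finset (Fin n)} (hU : U.Nonempty) :
    ∫ w, directCost w U ∂(weightLaw n) ≤ n / U.card := by
  unfold directCost
  rw [integral_finsetSum _ fun v _ => integrable_iInf_edgeWeight hU v]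
  refine (Finset.sum_le_sum fun v _ => integral_iInf_edgeWeight_le hU v).trans_eq ?_
  simp [div_eq_mul_inv]

lemma integrable_ratio {f : ℝ} (hf : 0 < f) {U : Finset (Fin n)} (hU : U.Nonempty) :
    Integrable (ratio f U) (weightLaw n) := by
  have : Nonempty (Fin n) := ⟨hU.choose⟩
  refine (((integrable_const (f * U.card)).add (integrable_directCost hU)).div_const f).mono'
    (measurable_ratio f U).aestronglyMeasurable ?_
  filter_upwards [ae_nonneg_weightLaw] with w hw
  have h1 := le_totalCost (f := f) hw U
  have h2 := le_opt hf.le hw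
  have h0 : 0 ≤ f * (U.card : ℝ) := by positivity
  rw [Real.norm_eq_abs, ratio, abs_of_nonneg (div_nonneg (h0.trans h1) (hf.le.trans h2))]
  have h3 := directCost_nonneg hw U
  exact div_le_div₀ (add_nonneg h0 h3) (totalCost_le f w hU) hf h2

end Direct

/-! ### The number of facilities. -/

section Kappa

lemma kappa_const {n : ℕ} (hn : 1 ≤ n) {f : ℝ} (hf : 0 < f) :
    kappa (fun _ : Fin n => f) = min ⌈1 / f⌉₊ n := by
  have hc : 1 ≤ ⌈1 / f⌉₊ := Nat.one_le_ceil_iff.2 (by positivity)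
  have hiff : ∀ j : ℕ, (j = 0 ∨ f < 1 / (j : ℝ)) ↔ j < ⌈1 / f⌉₊ := fun j => by
    rcases Nat.eq_zero_or_pos j with rfl | hj
    · simp only [true_or, true_iff]; omega
    · have hj' : (0 : ℝ) < j := by exact_mod_cast hj
      rw [Nat.lt_ceil, lt_div_comm₀ hf hj']
      simp [hj.ne']
  unfold kappa
  simp only [hiff]
  refine le_antisymm (Finset.sup_le fun j hj => ?_) ?_
  · have := (Finset.mem_filter.1 hj).2
    have := j.2
    omega
  -- The index is zero-based, so the value `min ⌈1 / f⌉₊ n` is attained one position earlier.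
  · let j : Fin n := ⟨min ⌈1 / f⌉₊ n - 1, by omega⟩
    have hj : (j : ℕ) + 1 = min ⌈1 / f⌉₊ n := by simp only [j]; omega
    rw [← hj]
    refine Finset.le_sup (f := fun j : Fin n => (j : ℕ) + 1)
      (Finset.mem_filter.2 ⟨Finset.mem_univ j, by omega⟩)

variable {n : ℕ} {f : ℝ}

lemma kappa_pos (hn : 1 ≤ n) (hf : 0 < f) : 0 < kappa (fun _ : Fin n => f) := by
  rw [kappa_const hn hf]
  exact lt_min (Nat.ceil_pos.2 (by positivity)) hn

lemma kappa_eq_or (hn : 1 ≤ n) (hf : 0 < f) :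
    kappa (fun _ : Fin n => f) = n ∨ 1 ≤ n * f := by
  rw [kappa_const hn hf]
  rcases le_total n ⌈1 / f⌉₊ with h | h
  · exact Or.inl (min_eq_right h)
  · refine Or.inr ?_
    rwa [Nat.ceil_le, div_le_iff₀ hf] at h

lemma kappa_le_inv_add_one (hn : 1 ≤ n) (hf : 0 < f) :
    (kappa (fun _ : Fin n => f) : ℝ) ≤ 1 / f + 1 := by
  rw [kappa_const hn hf]
  refine le_trans ?_ (Nat.ceil_lt_add_one (by positivity : 0 ≤ 1 / f)).le
  exact_mod_cast min_le_left _ _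

end Kappa

/-! ### Pointwise and expected bounds on the ratio. -/

section Ratio

variable {n : ℕ} {f : ℝ} {U : Finset (Fin n)} {w : Edge (Fin n) → ℝ}

lemma one_le_ratio (hf : 0 < f) (hU : U.Nonempty) (hw : ∀ e, 0 ≤ w e) : 1 ≤ ratio f U w := by
  have : Nonempty (Fin n) := ⟨hU.choose⟩
  exact (one_le_div (hf.trans_le (le_opt hf.le hw))).2 (opt_le_totalCost f w hU)

lemma one_le_expectedRatio (hf : 0 < f) (hU : U.Nonempty) : 1 ≤ expectedRatio f U := by
  have h := integral_mono_ae (integrable_const (1 : ℝ)) (integrable_ratio hf hU)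
    (ae_nonneg_weightLaw.mono fun w hw => one_le_ratio hf hU hw)
  simpa [expectedRatio] using h

lemma directCost_le_mul (hUf : U = Finset.univ ∨ 1 ≤ n * f)
    (hw : ∀ e, 0 ≤ w e) : directCost w U ≤ n * f * directCost w U := by
  rcases hUf with rfl | h
  · rw [directCost_univ hw, mul_zero]
  · exact le_mul_of_one_le_left (directCost_nonneg hw U) h

lemma totalCost_le_mul (hf : 0 < f) (hU : U.Nonempty) (hUf : U = Finset.univ ∨ 1 ≤ n * f)
    (hw : ∀ e, 0 ≤ w e) :
    totalCost (fun _ => f) w U ≤ n * f * (1 + directCost w U) := by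
  have h1 := totalCost_le f w hU
  have h2 := directCost_le_mul hUf hw
  have h3 : (U.card : ℝ) ≤ n := by exact_mod_cast (Finset.card_le_univ U).trans_eq (by simp)
  nlinarith

lemma sq_directCost_le (hU : U.Nonempty) (hw : ∀ e, 0 ≤ w e) :
    directCost w U ^ 2 ≤ (n : ℝ) ^ 4 * ∑ e, w e ^ 2 := by
  have h1 := directCost_le hw hU
  rw [Fintype.card_fin] at h1
  calc directCost w U ^ 2 ≤ (n * ∑ e, w e) ^ 2 :=
        pow_le_pow_left₀ (directCost_nonneg hw U) h1 2
    _ = (n : ℝ) ^ 2 * (∑ e, w e) ^ 2 := by ring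
    _ ≤ (n : ℝ) ^ 2 * ((n : ℝ) ^ 2 * ∑ e, w e ^ 2) := by gcongr; exact sq_sum_weight_le w
    _ = _ := by ring

/-- If fewer than `n / 4` edges are lighter than `δ f`, then the optimum is at least `δ f n / 2`;
otherwise the last two terms dominate the trivial bound that `f ≤ opt` gives. -/
lemma ratio_le {δ : ℝ} (hf : 0 < f) (hδ : 0 < δ) (hδ1 : δ ≤ 1) (hU : U.Nonempty)
    (hUf : U = Finset.univ ∨ 1 ≤ n * f) (hw : ∀ e, 0 ≤ w e) :
    ratio f U w ≤ 2 / δ * (1 + directCost w U) +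
      (2 * n * Real.exp (-(7 * n / 16)) * Real.exp (2 * lightCount w (δ * f)) +
        (n : ℝ) ^ 5 * Real.exp (-(n / 16)) * ∑ e, w e ^ 2) := by
  have : Nonempty (Fin n) := ⟨hU.choose⟩
  have hn : (0 : ℝ) < n := by
    exact_mod_cast (Fin.pos hU.choose)
  have hD := directCost_nonneg hw U
  have hT := totalCost_le_mul hf hU hUf hw
  have hS := sq_directCost_le hU hw
  have hS0 : 0 ≤ ∑ e, w e ^ 2 := Finset.sum_nonneg fun e _ => sq_nonneg _
  have hO := le_opt hf.le hw
  set D := directCost w U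
  set S := ∑ e, w e ^ 2
  rcases lt_or_ge (lightCount w (δ * f) : ℝ) (n / 4) with hX | hX
  · have hO' := mul_card_sub_le_opt (by positivity) (mul_le_of_le_one_left hf.le hδ1) hw
    rw [Fintype.card_fin] at hO'
    have hO2 : δ * f * (n / 2) ≤ opt (fun _ => f) w :=
      le_trans (mul_le_mul_of_nonneg_left (by linarith) (by positivity)) hO'
    have : ratio f U w ≤ 2 / δ * (1 + D) := by
      refine (div_le_div₀ (by positivity) hT (by positivity) hO2).trans_eq ?_
      field_simp
    exact this.trans (le_add_of_nonneg_right (by positivity))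
  · have h1 : ratio f U w ≤ n * (1 + D) := by
      refine (div_le_div₀ (by positivity) hT hf hO).trans_eq ?_
      field_simp
    -- Here `2 * lightCount ≥ n / 2`, and `1/2 - 7/16 = 1/16`.
    have hq : Real.exp (n / 16) ≤
        Real.exp (-(7 * n / 16)) * Real.exp (2 * lightCount w (δ * f)) := by
      rw [← Real.exp_add, Real.exp_le_exp]; linarith
    have hq1 : 1 ≤ Real.exp ((n : ℝ) / 16) := Real.one_le_exp (by positivity)
    have hqi : Real.exp (-((n : ℝ) / 16)) * Real.exp (n / 16) = 1 := by
      rw [← Real.exp_add]; simp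
    have hp := Real.exp_pos (-((n : ℝ) / 16))
    set q := Real.exp ((n : ℝ) / 16)
    set p := Real.exp (-((n : ℝ) / 16))
    set Z := Real.exp (-(7 * n / 16)) * Real.exp (2 * lightCount w (δ * f))
    -- From `x ≤ x ^ 2 + 1` at `x = p * D`, multiplied by `q = 1 / p`. This separates `D` from the
    -- bad event without Cauchy–Schwarz for integrals.
    have hDq : D ≤ p * D ^ 2 + q := by
      have : D = (p * D) * q := by rw [mul_right_comm, hqi, one_mul]
      have h2 : p * D ^ 2 = (p * D) ^ 2 * q := by
        calc p * D ^ 2 = p * D ^ 2 * (p * q) := by rw [hqi, mul_one]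
          _ = _ := by ring
      rw [h2]
      nlinarith [sq_nonneg (p * D - 1), mul_nonneg hp.le hD]
    have h3 : 1 + D ≤ 2 * Z + p * ((n : ℝ) ^ 4 * S) := by
      have := mul_le_mul_of_nonneg_left hS hp.le
      linarith
    calc ratio f U w ≤ n * (2 * Z + p * ((n : ℝ) ^ 4 * S)) :=
          h1.trans (mul_le_mul_of_nonneg_left h3 hn.le)
      _ = 2 * n * Real.exp (-(7 * n / 16)) * Real.exp (2 * lightCount w (δ * f)) +
          (n : ℝ) ^ 5 * p * S := by simp only [Z]; ring
      _ ≤ _ := le_add_of_nonneg_left (by positivity)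

/-- A single term of the exponential series at `n / 16` is at most the whole sum. -/
lemma natCast_pow_mul_exp_le (k n : ℕ) :
    (n : ℝ) ^ k * Real.exp (-(n / 16)) ≤ 16 ^ k * k.factorial := by
  have h := Real.pow_div_factorial_le_exp (n / 16 : ℝ) (by positivity) k
  rw [div_le_iff₀ (by positivity), div_pow, div_le_iff₀ (by positivity)] at h
  rw [Real.exp_neg, ← div_eq_mul_inv, div_le_iff₀ (Real.exp_pos _)]
  linarith

lemma exp_two_sub_one_le : Real.exp 2 - 1 ≤ 8 := by
  have h : Real.exp 2 = Real.exp 1 ^ 2 := by rw [← Real.exp_nat_mul]; norm_num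
  have h1 := Real.exp_one_lt_d9
  have h0 := Real.exp_pos 1
  rw [h]
  nlinarith

lemma expectedRatio_le {δ : ℝ} (hf : 0 < f) (hδ : 0 < δ) (hδ1 : δ ≤ 1)
    (hδf : n * (δ * f) ≤ 1 / 64) (hU : U.Nonempty) (hUf : U = Finset.univ ∨ 1 ≤ n * f) :
    expectedRatio f U ≤ 2 / δ * (1 + n / U.card) +
      (32 + 16 ^ 7 * (Nat.factorial 7) * ∫ x, x ^ 2 ∂(expMeasure 1)) := by
  have iD := ((integrable_const (1 : ℝ)).add (integrable_directCost hU)).const_mul (2 / δ)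
  have iX := (integrable_exp_mul_lightCount (n := n) 2 (δ * f)).const_mul
    (2 * n * Real.exp (-(7 * n / 16)))
  have iS := (integrable_sum_weight_sq (n := n)).const_mul ((n : ℝ) ^ 5 * Real.exp (-(n / 16)))
  have hK : 0 ≤ ∫ x, x ^ 2 ∂(expMeasure 1) := integral_nonneg fun x => sq_nonneg x
  have h := integral_mono_ae (integrable_ratio hf hU) (iD.add (iX.add iS))
    (ae_nonneg_weightLaw.mono fun w hw => ratio_le hf hδ hδ1 hU hUf hw)
  rw [integral_add' iD (iX.add iS), integral_add' iX iS, integral_const_mul, integral_const_mul,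
    integral_const_mul, integral_add' (integrable_const _) (integrable_directCost hU)] at h
  simp only [integral_const, probReal_univ, smul_eq_mul, mul_one] at h
  refine h.trans (add_le_add ?_ (add_le_add ?_ ?_))
  · gcongr
    exact integral_directCost_le hU
  -- With `exp 2 - 1 ≤ 8` and `n δ f ≤ 1/64`, the Chernoff exponent is at most `8 * (n / 64) / 2 = n
  -- / 16`, well below the compensating `7 n / 16`.
  · have h2 : ∫ w, Real.exp (2 * lightCount w (δ * f)) ∂(weightLaw n) ≤ Real.exp (n / 16) := by
      refine (integral_exp_mul_lightCount_le zero_le_two (by positivity)).trans ?_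
      rw [Real.exp_le_exp]
      have h8 := exp_two_sub_one_le
      have : (Real.exp 2 - 1) * (δ * f * (n : ℝ) ^ 2 / 2) ≤ 8 * (δ * f * (n : ℝ) ^ 2 / 2) :=
        mul_le_mul_of_nonneg_right h8 (by positivity)
      have hn : (0 : ℝ) ≤ n := n.cast_nonneg
      nlinarith [mul_le_mul_of_nonneg_left hδf hn]
    have h3 := natCast_pow_mul_exp_le 1 n
    have h4 : Real.exp (-(7 * n / 16)) * Real.exp (n / 16) ≤ Real.exp (-((n : ℝ) / 16)) := by
      rw [← Real.exp_add, Real.exp_le_exp]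
      have hn : (0 : ℝ) ≤ n := n.cast_nonneg
      linarith
    calc _ ≤ 2 * n * Real.exp (-(7 * n / 16)) * Real.exp (n / 16) := by gcongr
      _ = 2 * (n * (Real.exp (-(7 * n / 16)) * Real.exp (n / 16))) := by ring
      _ ≤ 2 * (n * Real.exp (-((n : ℝ) / 16))) := by gcongr
      _ ≤ 32 := by norm_num at h3; linarith
  · calc _ ≤ (n : ℝ) ^ 5 * Real.exp (-(n / 16)) *
          ((n : ℝ) ^ 2 * ∫ x, x ^ 2 ∂(expMeasure 1)) := by
          gcongr; exact integral_sum_weight_sq_le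
      _ = (n : ℝ) ^ 7 * Real.exp (-(n / 16)) * ∫ x, x ^ 2 ∂(expMeasure 1) := by ring
      _ ≤ _ := mul_le_mul_of_nonneg_right (natCast_pow_mul_exp_le 7 n) hK

/-- With no edge lighter than `f`, opening every vertex is optimal; otherwise the trivial bound `n`
is absorbed by `n * lightCount`. -/
lemma ratio_univ_le [Nonempty (Fin n)] (hf : 0 < f) (hw : ∀ e, 0 ≤ w e) :
    ratio f Finset.univ w ≤ 1 + n * lightCount w f := by
  have hn : (0 : ℝ) < n := by exact_mod_cast Fin.pos (Classical.arbitrary (Fin n))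
  have hT : totalCost (fun _ => f) w Finset.univ ≤ f * n := by
    simpa [directCost_univ hw] using totalCost_le f w (Finset.univ_nonempty (α := Fin n))
  rcases Nat.eq_zero_or_pos (lightCount w f) with hX | hX
  · have hO := mul_card_sub_le_opt hf.le le_rfl hw
    rw [hX, Fintype.card_fin] at hO
    simp only [Nat.cast_zero, mul_zero, sub_zero] at hO
    rw [hX, Nat.cast_zero, mul_zero, add_zero]
    exact div_le_one_of_le₀ (hT.trans hO) ((by positivity : 0 ≤ f * n).trans hO)
  · have h1 : ratio f Finset.univ w ≤ n := by
      refine (div_le_div₀ (by positivity) hT hf (le_opt hf.le hw)).trans_eq ?_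
      field_simp
    have hX' : (1 : ℝ) ≤ lightCount w f := by exact_mod_cast hX
    nlinarith

lemma expectedRatio_univ_le [Nonempty (Fin n)] (hf : 0 < f) :
    expectedRatio f (Finset.univ : Finset (Fin n)) ≤ 1 + (n : ℝ) ^ 3 * f := by
  have iX := (integrable_lightCount (n := n) f).const_mul n
  have h := integral_mono_ae (integrable_ratio hf Finset.univ_nonempty)
    ((integrable_const (1 : ℝ)).add iX)
    (ae_nonneg_weightLaw.mono fun w hw => ratio_univ_le hf hw)
  rw [integral_add' (integrable_const _) iX, integral_const_mul] at h
  simp only [integral_const, probReal_univ, smul_eq_mul, mul_one] at h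
  refine h.trans (add_le_add le_rfl ?_)
  calc (n : ℝ) * ∫ w, (lightCount w f : ℝ) ∂(weightLaw n) ≤ n * ((n : ℝ) ^ 2 * f) := by
        gcongr; exact integral_lightCount_le hf.le
    _ = _ := by ring

end Ratio

/-! ### Letting `n` tend to infinity. -/

section Asymptotic

variable {f : ℕ → ℝ} {U : ∀ n : ℕ, Finset (Fin n)}

lemma nonempty_of_card_eq_kappa (hf : ∀ n, 1 ≤ n → 0 < f n)
    (hU : ∀ n, (U n).card = kappa (fun _ : Fin n => f n)) {n : ℕ} (hn : 1 ≤ n) :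
    (U n).Nonempty := by
  rw [← Finset.card_pos, hU n]
  exact kappa_pos hn (hf n hn)

lemma eq_univ_or_of_card_eq_kappa (hf : ∀ n, 1 ≤ n → 0 < f n)
    (hU : ∀ n, (U n).card = kappa (fun _ : Fin n => f n)) {n : ℕ} (hn : 1 ≤ n) :
    U n = Finset.univ ∨ 1 ≤ n * f n :=
  (kappa_eq_or hn (hf n hn)).imp_left fun h =>
    (Finset.card_eq_iff_eq_univ _).1 (by rw [hU n, h, Fintype.card_fin])

/-- The expected approximation ratio is bounded whenever `κ = Θ(n)`. -/
lemma expectedRatio_isBigO_one (hf : ∀ n, 1 ≤ n → 0 < f n)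
    (hκ : (fun n : ℕ => (n : ℝ)) =O[atTop]
      fun n : ℕ => (kappa (fun _ : Fin n => f n) : ℝ))
    (hU : ∀ n, (U n).card = kappa (fun _ : Fin n => f n)) :
    (fun n : ℕ => expectedRatio (f n) (U n)) =O[atTop] fun _ : ℕ => (1 : ℝ) := by
  obtain ⟨c, hc, hb⟩ := hκ.exists_pos
  rw [IsBigOWith] at hb
  -- Chosen so that the bound `n f ≤ 2 c` proved below yields `n δ f ≤ 1/64`.
  set δ : ℝ := min 1 (1 / (128 * c)) with hδdef
  have hδ : 0 < δ := lt_min one_pos (by positivity)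
  refine IsBigO.of_bound (2 / δ * (1 + c) +
      (32 + 16 ^ 7 * (Nat.factorial 7) * ∫ x, x ^ 2 ∂(expMeasure 1))) ?_
  -- For `n ≥ 2 c`, the extra `c` in `n ≤ c (1 / f + 1)` is at most `n / 2` and can be absorbed on
  -- the left.
  filter_upwards [hb, eventually_ge_atTop 1, eventually_ge_atTop ⌈2 * c⌉₊] with n hbn hn hn2
  have hfn := hf n hn
  have hUn := nonempty_of_card_eq_kappa hf hU hn
  have hn2' : 2 * c ≤ n := Nat.ceil_le.1 hn2
  simp only [Real.norm_natCast] at hbn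
  have hk := kappa_le_inv_add_one hn hfn
  have hnf : n * f n ≤ 2 * c := by
    have h1 : (n : ℝ) ≤ c * (1 / f n + 1) := hbn.trans (by gcongr)
    have h2 : (n : ℝ) ≤ 2 * c * (1 / f n) := by linarith
    calc (n : ℝ) * f n ≤ 2 * c * (1 / f n) * f n := by gcongr
      _ = 2 * c := by field_simp
  have hδf : n * (δ * f n) ≤ 1 / 64 := by
    calc n * (δ * f n) = δ * (n * f n) := by ring
      _ ≤ 1 / (128 * c) * (2 * c) := by gcongr; exact min_le_right _ _
      _ = 1 / 64 := by field_simp; norm_num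
  have hle := expectedRatio_le hfn hδ (min_le_left _ _) hδf hUn
    (eq_univ_or_of_card_eq_kappa hf hU hn)
  have hcard : (n : ℝ) / (U n).card ≤ c := by
    rw [div_le_iff₀ (by exact_mod_cast hUn.card_pos), hU n]
    exact hbn
  rw [norm_one, mul_one, Real.norm_eq_abs,
    abs_of_nonneg (zero_le_one.trans (one_le_expectedRatio hfn hUn))]
  refine hle.trans (add_le_add ?_ le_rfl)
  gcongr

lemma tendsto_expectedRatio (hf : ∀ n, 1 ≤ n → 0 < f n)
    (hU : ∀ n, (U n).card = kappa (fun _ : Fin n => f n))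
    (hfo : f =o[atTop] fun n : ℕ => 1 / (n : ℝ) ^ 3) :
    Tendsto (fun n : ℕ => expectedRatio (f n) (U n)) atTop (𝓝 1) := by
  have h0 : Tendsto (fun n : ℕ => (n : ℝ) ^ 3 * f n) atTop (𝓝 0) := by
    refine hfo.tendsto_div_nhds_zero.congr fun n => ?_
    rw [div_div_eq_mul_div, div_one, mul_comm]
  have h1 : Tendsto (fun n : ℕ => 1 + (n : ℝ) ^ 3 * f n) atTop (𝓝 1) := by
    simpa using h0.const_add 1
  refine tendsto_of_tendsto_of_tendsto_of_le_of_le' tendsto_const_nhds h1 ?_ ?_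
  · filter_upwards [eventually_ge_atTop 1] with n hn
    exact one_le_expectedRatio (hf n hn) (nonempty_of_card_eq_kappa hf hU hn)
  · filter_upwards [eventually_ge_atTop 1, h0.eventually (gt_mem_nhds one_pos)] with n hn hlt
    have hfn := hf n hn
    have : Nonempty (Fin n) := ⟨⟨0, hn⟩⟩
    have hn' : (1 : ℝ) ≤ n := by exact_mod_cast hn
    -- The alternative `n f ≥ 1` would contradict `n ^ 3 f < 1`.
    have huniv : U n = Finset.univ := by
      refine (eq_univ_or_of_card_eq_kappa hf hU hn).resolve_right fun h => ?_
      have : (n : ℝ) * f n ≤ (n : ℝ) ^ 3 * f n := by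
        gcongr
        exact le_self_pow₀ hn' (by norm_num)
      linarith
    rw [huniv]
    exact expectedRatio_univ_le hfn

end Asymptotic

end FacilityLocation

theorem corollary1 (f : ℕ → ℝ) (hf : ∀ n, 1 ≤ n → 0 < f n)
    (hκ : (fun n : ℕ => (FacilityLocation.kappa (fun _ : Fin n => f n) : ℝ))
      =Θ[atTop] (fun n : ℕ => (n : ℝ)))
    (U : ∀ n : ℕ, Finset (Fin n))
    (hU : ∀ n, (U n).card = FacilityLocation.kappa (fun _ : Fin n => f n)) :
    (∀ n, 1 ≤ n → FacilityLocation.kappa (fun _ : Fin n => f n) = min ⌈1 / f n⌉₊ n) ∧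
    (∀ n, 1 ≤ n →
      Integrable (FacilityLocation.ratio (f n) (U n)) (FacilityLocation.weightLaw n)) ∧
    ((fun n : ℕ => FacilityLocation.expectedRatio (f n) (U n)) =O[atTop]
      (fun n : ℕ => 1 + (Real.log n * (n : ℝ) ^ 3 * f n ^ 3) ^ (1 / 4 : ℝ))) ∧
    ((fun n : ℕ => FacilityLocation.expectedRatio (f n) (U n)) =O[atTop]
      (fun n : ℕ => Real.log n ^ (1 / 4 : ℝ))) ∧
    (f =O[atTop] (fun n : ℕ => 1 / ((n : ℝ) * Real.log n ^ (1 / 3 : ℝ))) →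
      (fun n : ℕ => FacilityLocation.expectedRatio (f n) (U n)) =O[atTop]
        (fun _ : ℕ => (1 : ℝ))) ∧
    (f =o[atTop] (fun n : ℕ => 1 / (n : ℝ) ^ 3) →
      Tendsto (fun n : ℕ => FacilityLocation.expectedRatio (f n) (U n)) atTop (𝓝 1)) := by

  -- Boundedness suffices for all three big-O claims: the first comparison function is at least 1
  -- for `n ≥ 1`, the second once `log n ≥ 1`, and the third is the constant 1.
  have hbdd := FacilityLocation.expectedRatio_isBigO_one hf hκ.2 hU
  refine ⟨fun n hn => FacilityLocation.kappa_const hn (hf n hn), fun n hn =>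
    FacilityLocation.integrable_ratio (hf n hn)
      (FacilityLocation.nonempty_of_card_eq_kappa hf hU hn), hbdd.trans ?_, hbdd.trans ?_,
    fun _ => hbdd, FacilityLocation.tendsto_expectedRatio hf hU⟩
  · refine IsBigO.of_bound 1 ?_
    filter_upwards [eventually_ge_atTop 1] with n hn
    have hfn := hf n hn
    have h : 0 ≤ (Real.log n * (n : ℝ) ^ 3 * f n ^ 3) ^ (1 / 4 : ℝ) := by positivity
    rw [norm_one, one_mul, Real.norm_eq_abs, abs_of_nonneg (by linarith)]
    linarith
  · refine IsBigO.of_bound 1 ?_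
    have hlog : Tendsto (fun n : ℕ => Real.log n) atTop atTop :=
      Real.tendsto_log_atTop.comp tendsto_natCast_atTop_atTop
    filter_upwards [hlog.eventually_ge_atTop 1] with n hn
    have h := Real.one_le_rpow hn (by norm_num : (0 : ℝ) ≤ 1 / 4)
    rw [norm_one, one_mul, Real.norm_eq_abs, abs_of_nonneg (by linarith)]
    exact h
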